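/- Let $\mathsf{Brw}$ be the type of Brouwer trees: the quotient inductive-inductive type (initial such structure) consisting of a set $\mathsf{Brw}$ with constructors $\mathsf{zero}$, $\mathsf{succ} : \mathsf{Brw} \to \mathsf{Brw}$, and $\mathsf{limit}\, f$ for every sequence $f : \mathbb N \to \mathsf{Brw}$ with $f(k) < f(k+1)$ for all $k$, where $x < y$ means $\mathsf{succ}\, x \le y$, with $\mathsf{limit}\, f = \mathsf{limit}\, g$ whenever $\forall k\, \exists n\, f(k) \le g(n)$ and $\forall k\, \exists n\, g(k) \le f(n)$; simultaneously, the proposition-valued relation $\le$ on $\mathsf{Brw}$ is generated by: $\mathsf{zero} \le x$; transitivity; $x \le y \Rightarrow \mathsf{succ}\, x \le \mathsf{succ}\, y$; $x \le f(k) \Rightarrow x \le \mathsf{limit}\, f$; and $(\forall k.\ f(k) \le x) \Rightarrow \mathsf{limit}\, f \le x$. For a set $A$ with relations $<$, $\le$, call $a$ zero if $a \le b$ for all $b$; a successor of $b$ if $b < a$ and $a \le x$ for all $x > b$; the supremum of $f : \mathbb N \to A$ if it is a least upper bound of $f$ with respect to $\le$; and the limit of $f$ if $f$ is strictly increasing ($f_k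 < f_{k+1}$ for all $k$) and $a$ is its supremum. Consider the following specifications (for all $a,b,c,d \in A$ and all strictly increasing $f : \mathbb N \to A$, except that in the third one the base $c$ is fixed). \begin{itemize} \item \emph{Addition} $+ : A \to A \to A$: if $a$ is zero then $c + a = c$; if $a$ is a successor of $b$ and $d$ is a successor of $c + b$, then $c + a = d$; if $a$ is the limit of $f$ and $b$ is the supremum of $i \mapsto c + f_i$, then $c + a = b$. \item \emph{Multiplication} $\cdot : A \to A \to A$, relative to $+$: if $a$ is zero then $c \cdot a = a$; if $a$ is a successor of $b$ then $c \cdot a = c \cdot b + c$; if $a$ is the limit of $f$ and $b$ is the supremum of $i \mapsto c \cdot f_i$, then $c \cdot a = b$. \item \emph{Exponentiation with base $c$}, $c^{(-)} : A \to A$, relative to $\cdot$: if $b$ is zero and $a$ is a successor of $b$, then $c^b = a$; if $a$ is a successor of $b$ then $c^a = c^b \cdot c$; if $a$ is the limit of $f$, $c$ is not zero and $b$ is the supremum of $i \mapsto c^{f_i}$, then $c^a = b$; if $a$ is the limit of $f$ and $c$ is zero, then $c^a = c$. \end{itemize} Theorem. On $\mathsf{Brw}$, the relation $<$ is transitive and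 irreflexive, $\le$ is reflexive, transitive and antisymmetric, $x < y$ implies $x \le y$, and $x < y \le z$ implies $x < z$. Moreover, there is exactly one function satisfying the specification of addition; relative to it, exactly one function satisfying the specification of multiplication; and relative to these, for every base $c$, exactly one function satisfying the specification of exponentiation with base $c$. These functions are given by the following equations, in which every sequence whose limit is taken is strictly increasing: \begin{align*} & x + \mathsf{zero} = x, \qquad x + \mathsf{succ}\, y = \mathsf{succ}(x + y), \qquad x + \mathsf{limit}\, f = \mathsf{limit}(\lambda k.\, x + f(k)); \\ & x \cdot \mathsf{zero} = \mathsf{zero}, \qquad x \cdot \mathsf{succ}\, y = (x \cdot y) + x, \\ & x \cdot \mathsf{limit}\, f = \mathsf{zero} \text{ if } x = \mathsf{zero}, \text{ and } \mathsf{limit}(\lambda k.\, x \cdot f(k)) \text{ otherwise}; \\ & x^{\mathsf{zero}} = \mathsf{succ}\,\mathsf{zero}, \qquad x^{\mathsf{succ}\, y} = (x^y) \cdot x, \\ & x^{\mathsf{limit}\, f} = \mathsf{zero} \text{ if } x = \mathsf{zero}, \ \mathsf{succ}\,\mathsf{zero} \text{ if } x = \mathsf{succ}\,\mathsf{zero},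 \text{ and } \mathsf{limit}(\lambda k.\, x^{f(k)}) \text{ otherwise}. \end{align*} -/

import Mathlib

universe u

/-! ## The abstract framework: a set with two relations `<` and `≤` -/

/-- The strictly increasing sequences `ℕ → A`. -/
abbrev IncSeq (A : Type u) [LT A] : Type u := {f : ℕ → A // ∀ k, f k < f (k + 1)}

section Framework

variable {A : Type u} [LT A] [LE A]

/-- `a` is zero: it is below every element. -/
def IsZeroElt (a : A) : Prop := ∀ b : A, a ≤ b

/-- `a` is a successor of `b`: the least element strictly above `b`. -/
def IsSucOf (a b : A) : Prop := b < a ∧ ∀ x : A, b < x → a ≤ x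

/-- `a` is the supremum of the sequence `f`. -/
def IsSupOf (a : A) (f : ℕ → A) : Prop :=
  (∀ i, f i ≤ a) ∧ ∀ b : A, (∀ i, f i ≤ b) → a ≤ b

/-- `a` is the limit of the strictly increasing sequence `f`. -/
def IsLimOf (a : A) (f : IncSeq A) : Prop := IsSupOf a f.1

variable (A) in
/-- The standing assumptions on a triple `(A, <, ≤)`. -/
structure OrdinalAssumptions : Prop where
  lt_trans : ∀ x y z : A, x < y → y < z → x < z
  lt_irrefl : ∀ x : A, ¬ x < x
  le_refl : ∀ x : A, x ≤ x
  le_trans : ∀ x y z : A, x ≤ y → y ≤ z → x ≤ z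
  le_antisymm : ∀ x y : A, x ≤ y → y ≤ x → x = y
  le_of_lt : ∀ x y : A, x < y → x ≤ y
  lt_of_lt_of_le : ∀ x y z : A, x < y → y ≤ z → x < z

/-- The specification of addition. -/
structure IsAddition (add : A → A → A) : Prop where
  zero : ∀ a c : A, IsZeroElt a → add c a = c
  succ : ∀ a b c d : A, IsSucOf a b → IsSucOf d (add c b) → add c a = d
  lim : ∀ (a b c : A) (f : IncSeq A),
    IsLimOf a f → IsSupOf b (fun i => add c (f.1 i)) → add c a = b

/-- The specification of multiplication, relative to an addition. -/
structure IsMultiplication (add mul : A → A → A) : Prop where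
  zero : ∀ a c : A, IsZeroElt a → mul c a = a
  succ : ∀ a b c : A, IsSucOf a b → mul c a = add (mul c b) c
  lim : ∀ (a b c : A) (f : IncSeq A),
    IsLimOf a f → IsSupOf b (fun i => mul c (f.1 i)) → mul c a = b

/-- The specification of exponentiation with base `c`, relative to a multiplication. -/
structure IsExponentiation (mul : A → A → A) (c : A) (pow : A → A) : Prop where
  zero : ∀ a b : A, IsZeroElt b → IsSucOf a b → pow b = a
  succ : ∀ a b : A, IsSucOf a b → pow a = mul (pow b) c
  lim : ∀ (a b : A) (f : IncSeq A),
    IsLimOf a f → ¬ IsZeroElt c → IsSupOf b (fun i => pow (f.1 i)) → pow a = b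
  lim_of_zero : ∀ (a : A) (f : IncSeq A), IsLimOf a f → IsZeroElt c → pow a = c

variable (A) in
/-- `A` has unique addition. -/
def HasUniqueAddition : Prop := ∃! add : A → A → A, IsAddition add

variable (A) in
/-- `A` has unique multiplication. -/
def HasUniqueMultiplication : Prop :=
  HasUniqueAddition A ∧
    ∀ add : A → A → A, IsAddition add → ∃! mul : A → A → A, IsMultiplication add mul

/-- `A` has unique exponentiation with base `c`. -/
def HasUniqueExponentiation (c : A) : Prop :=
  HasUniqueMultiplication A ∧
    ∀ add mul : A → A → A, IsAddition add → IsMultiplication add mul →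
      ∃! pow : A → A, IsExponentiation mul c pow

end Framework

/-! ## Brouwer trees

The quotient inductive-inductive type of Brouwer trees is built as follows: raw trees; the
mutually inductive predicates "hereditarily, only limits of strictly increasing sequences are
taken" and `≤`; and the quotient by the congruence that is generated by identifying limits of
bisimilar sequences. -/

/-- Raw trees. -/
inductive RawBrw : Type
  | zero : RawBrw
  | succ : RawBrw → RawBrw
  | limit : (ℕ → RawBrw) → RawBrw

namespace RawBrw

mutual

/-- Well-formed trees: limits are taken of strictly increasing sequences only. -/
inductive WF : RawBrw → Prop
  | zero : WF zero
  | succ {x : RawBrw} : WF x → WF (succ x)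
  | limit {f : ℕ → RawBrw} :
      (∀ k, WF (f k)) → (∀ k, Le (succ (f k)) (f (k + 1))) → WF (limit f)

/-- The order relation between well-formed trees. -/
inductive Le : RawBrw → RawBrw → Prop
  | zero_le {x : RawBrw} : WF x → Le zero x
  | trans {x y z : RawBrw} : Le x y → Le y z → Le x z
  | succ_mono {x y : RawBrw} : Le x y → Le (succ x) (succ y)
  | cocone {x : RawBrw} {f : ℕ → RawBrw} (k : ℕ) : WF (limit f) → Le x (f k) → Le x (limit f)
  | limiting {x : RawBrw} {f : ℕ → RawBrw} :
      WF (limit f) → (∀ k, Le (f k) x) → Le (limit f) x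

end

/-- The congruence generated by identifying the limits of bisimilar sequences. (Congruence with
respect to `limit` is a special case of `bisim`.) -/
inductive Eqv : RawBrw → RawBrw → Prop
  | refl (x : RawBrw) : Eqv x x
  | symm {x y : RawBrw} : Eqv x y → Eqv y x
  | trans {x y z : RawBrw} : Eqv x y → Eqv y z → Eqv x z
  | succ {x y : RawBrw} : Eqv x y → Eqv (succ x) (succ y)
  | bisim {f g : ℕ → RawBrw} : WF (limit f) → WF (limit g) →
      (∀ k, ∃ n, Le (f k) (g n)) → (∀ k, ∃ n, Le (g k) (f n)) → Eqv (limit f) (limit g)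

theorem WF.of_succ {x : RawBrw} (h : WF (RawBrw.succ x)) : WF x := by
  cases h with
  | succ h => exact h

theorem Le.refl : ∀ {x : RawBrw}, WF x → Le x x := by
  intro x
  induction x with
  | zero => exact fun h => Le.zero_le h
  | succ x ih => exact fun h => Le.succ_mono (ih h.of_succ)
  | limit f ih =>
    intro h
    refine Le.limiting h fun k => Le.cocone k h (ih k ?_)
    cases h with
    | limit h _ => exact h k

theorem Eqv.le_iff {x y : RawBrw} (h : Eqv x y) :
    (WF x ↔ WF y) ∧ (WF x → Le x y ∧ Le y x) := by
  induction h with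
  | refl x => exact ⟨Iff.rfl, fun h => ⟨Le.refl h, Le.refl h⟩⟩
  | symm _ ih => exact ⟨ih.1.symm, fun h => (ih.2 (ih.1.2 h)).symm⟩
  | trans _ _ ih₁ ih₂ =>
    refine ⟨ih₁.1.trans ih₂.1, fun h => ?_⟩
    have h₁ := ih₁.2 h
    have h₂ := ih₂.2 (ih₁.1.1 h)
    exact ⟨h₁.1.trans h₂.1, h₂.2.trans h₁.2⟩
  | succ _ ih =>
    exact ⟨⟨fun h => .succ (ih.1.1 h.of_succ), fun h => .succ (ih.1.2 h.of_succ)⟩,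
      fun h => ⟨.succ_mono (ih.2 h.of_succ).1, .succ_mono (ih.2 h.of_succ).2⟩⟩
  | bisim hf hg h₁ h₂ =>
    exact ⟨⟨fun _ => hg, fun _ => hf⟩, fun _ =>
      ⟨.limiting hf fun k => (h₁ k).elim fun n hn => .cocone n hg hn,
        .limiting hg fun k => (h₂ k).elim fun n hn => .cocone n hf hn⟩⟩

instance setoid : Setoid {x : RawBrw // WF x} where
  r x y := Eqv x.1 y.1
  iseqv := ⟨fun _ => .refl _, .symm, .trans⟩

end RawBrw

/-- The type of Brouwer trees. -/
def Brw : Type := Quotient RawBrw.setoid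

namespace Brw

open RawBrw (WF Le Eqv)

/-- The class of a well-formed raw tree. -/
def mk (a : {x : RawBrw // WF x}) : Brw := Quotient.mk _ a

/-- A representative of a Brouwer tree. -/
noncomputable def rep (x : Brw) : {x : RawBrw // WF x} := Quotient.out x

theorem mk_rep (x : Brw) : mk (rep x) = x := Quotient.out_eq x

theorem mk_eq_mk {a b : {x : RawBrw // WF x}} : mk a = mk b ↔ Eqv a.1 b.1 :=
  ⟨fun h => Quotient.exact h, fun h => Quotient.sound h⟩

/-- The order relation of Brouwer trees. -/
instance : LE Brw where
  le x y := Quotient.liftOn₂ x y (fun a b => Le a.1 b.1) fun a b a' b' ha hb => by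
    have h₁ := (Eqv.le_iff ha).2 a.2
    have h₂ := (Eqv.le_iff hb).2 b.2
    exact propext ⟨fun h => (h₁.2.trans h).trans h₂.1, fun h => (h₁.1.trans h).trans h₂.2⟩

theorem mk_le_mk {a b : {x : RawBrw // WF x}} : mk a ≤ mk b ↔ Le a.1 b.1 := Iff.rfl

/-- Zero. -/
def zero : Brw := mk ⟨.zero, .zero⟩

/-- The successor. -/
def succ (x : Brw) : Brw :=
  Quotient.map (fun a => ⟨.succ a.1, .succ a.2⟩) (fun _ _ h => Eqv.succ h) x

theorem succ_mk (a : {x : RawBrw // WF x}) : succ (mk a) = mk ⟨.succ a.1, .succ a.2⟩ := rfl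

/-- The strict order: `x < y` means `succ x ≤ y`. -/
instance : LT Brw where
  lt x y := succ x ≤ y

theorem mk_lt_mk {a b : {x : RawBrw // WF x}} : mk a < mk b ↔ Le (.succ a.1) b.1 := Iff.rfl

theorem rep_lt {x y : Brw} (h : x < y) : Le (.succ (rep x).1) (rep y).1 := by
  rw [← mk_rep x, ← mk_rep y] at h
  exact h

theorem rep_le {x y : Brw} (h : x ≤ y) : Le (rep x).1 (rep y).1 := by
  rw [← mk_rep x, ← mk_rep y] at h
  exact h

theorem wf_limit_rep (f : IncSeq Brw) : WF (.limit fun k => (rep (f.1 k)).1) :=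
  .limit (fun k => (rep (f.1 k)).2) fun k => rep_lt (f.2 k)

/-- The limit of a strictly increasing sequence: the class of the limit of any sequence of
representatives. -/
noncomputable def limit (f : IncSeq Brw) : Brw :=
  mk ⟨.limit fun k => (rep (f.1 k)).1, wf_limit_rep f⟩

/-! The constructors of the quotient inductive-inductive type. -/

theorem bisim (f g : IncSeq Brw) (h₁ : ∀ k, ∃ n, f.1 k ≤ g.1 n) (h₂ : ∀ k, ∃ n, g.1 k ≤ f.1 n) :
    limit f = limit g :=
  mk_eq_mk.2 (.bisim (wf_limit_rep f) (wf_limit_rep g)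
    (fun k => (h₁ k).imp fun _ => rep_le) (fun k => (h₂ k).imp fun _ => rep_le))

theorem zero_le (x : Brw) : zero ≤ x := by
  rw [← mk_rep x]
  exact Le.zero_le (rep x).2

theorem le_trans {x y z : Brw} (h₁ : x ≤ y) (h₂ : y ≤ z) : x ≤ z := by
  rw [← mk_rep x, ← mk_rep z]
  exact Le.trans (rep_le h₁) (rep_le h₂)

theorem succ_mono {x y : Brw} (h : x ≤ y) : succ x ≤ succ y := by
  rw [← mk_rep x, ← mk_rep y]
  exact Le.succ_mono (rep_le h)

theorem le_limit (x : Brw) (f : IncSeq Brw) (k : ℕ) (h : x ≤ f.1 k) : x ≤ limit f := by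
  rw [← mk_rep x]
  exact Le.cocone k (wf_limit_rep f) (rep_le h)

theorem limit_le (x : Brw) (f : IncSeq Brw) (h : ∀ k, f.1 k ≤ x) : limit f ≤ x := by
  rw [← mk_rep x]
  exact Le.limiting (wf_limit_rep f) fun k => rep_le (h k)

theorem mk_limit (f : ℕ → RawBrw) (h : WF (.limit f)) (h₁ : ∀ k, WF (f k))
    (h₂ : ∀ k, mk ⟨f k, h₁ k⟩ < mk ⟨f (k + 1), h₁ (k + 1)⟩) :
    mk ⟨.limit f, h⟩ = limit ⟨fun k => mk ⟨f k, h₁ k⟩, h₂⟩ := by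
  refine mk_eq_mk.2 (.bisim h (wf_limit_rep _) (fun k => ⟨k, ?_⟩) (fun k => ⟨k, ?_⟩))
  · exact ((mk_eq_mk.1 (mk_rep (mk ⟨f k, h₁ k⟩))).symm.le_iff.2 (h₁ k)).1
  · exact ((mk_eq_mk.1 (mk_rep (mk ⟨f k, h₁ k⟩))).symm.le_iff.2 (h₁ k)).2

/-- Induction on Brouwer trees for families of propositions. -/
theorem induction {P : Brw → Prop} (h₀ : P zero) (h₁ : ∀ x, P x → P (succ x))
    (h₂ : ∀ f : IncSeq Brw, (∀ k, P (f.1 k)) → P (limit f)) (x : Brw) : P x := by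
  suffices h : ∀ (a : RawBrw) (ha : WF a), P (mk ⟨a, ha⟩) by
    rw [← mk_rep x]
    exact h _ _
  intro a
  induction a with
  | zero => exact fun _ => h₀
  | succ a ih => exact fun h => h₁ _ (ih h.of_succ)
  | limit f ih =>
    intro h
    have h' : (∀ k, WF (f k)) ∧ ∀ k, Le (.succ (f k)) (f (k + 1)) := by
      cases h with
      | limit h h' => exact ⟨h, h'⟩
    rw [mk_limit f h h'.1 h'.2]
    exact h₂ _ fun k => ih k _

/-! The universal property: `Brw` is the initial type with these constructors. -/

/-- A type with a relation and with all constructors of Brouwer trees. -/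
structure Alg (A : Type u) where
  le : A → A → Prop
  zero : A
  succ : A → A
  limit : {f : ℕ → A // ∀ k, le (succ (f k)) (f (k + 1))} → A
  bisim : ∀ f g, (∀ k, ∃ n, le (f.1 k) (g.1 n)) → (∀ k, ∃ n, le (g.1 k) (f.1 n)) →
    limit f = limit g
  zero_le : ∀ x, le zero x
  le_trans : ∀ x y z, le x y → le y z → le x z
  succ_mono : ∀ x y, le x y → le (succ x) (succ y)
  le_limit : ∀ x f k, le x (f.1 k) → le x (limit f)
  limit_le : ∀ x f, (∀ k, le (f.1 k) x) → le (limit f) x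

/-- `φ` preserves the relation and all constructors. -/
structure IsHom {A : Type u} (S : Alg A) (φ : Brw → A) : Prop where
  map_le : ∀ x y, x ≤ y → S.le (φ x) (φ y)
  map_zero : φ Brw.zero = S.zero
  map_succ : ∀ x, φ (Brw.succ x) = S.succ (φ x)
  map_limit : ∀ f : IncSeq Brw, φ (Brw.limit f) =
    S.limit ⟨fun k => φ (f.1 k), fun k => map_succ (f.1 k) ▸ map_le _ _ (f.2 k)⟩

open Classical in
/-- The value of a raw tree in `A`. -/
noncomputable def eval {A : Type u} (S : Alg A) : RawBrw → A
  | .zero => S.zero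
  | .succ x => S.succ (eval S x)
  | .limit f =>
    if h : ∀ k, S.le (S.succ (eval S (f k))) (eval S (f (k + 1))) then
      S.limit ⟨fun k => eval S (f k), h⟩ else S.zero

theorem eval_le {A : Type u} (S : Alg A) {x y : RawBrw} (h : Le x y) :
    S.le (eval S x) (eval S y) := by
  refine Le.rec
    (motive_1 := fun x _ => ∀ f, x = .limit f →
      ∀ k, S.le (S.succ (eval S (f k))) (eval S (f (k + 1))))
    (motive_2 := fun x y _ => S.le (eval S x) (eval S y))
    ?_ ?_ ?_ ?_ ?_ ?_ ?_ ?_ h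
  · intro f h; cases h
  · intro x _ _ f h; cases h
  · intro f _ _ _ h g hg k
    cases hg
    exact h k
  · intro x _ _
    exact S.zero_le _
  · intro x y z _ _ h₁ h₂
    exact S.le_trans _ _ _ h₁ h₂
  · intro x y _ h
    exact S.succ_mono _ _ h
  · intro x f k _ _ hf h
    have e : eval S (.limit f) = _ := dif_pos (hf f rfl)
    rw [e]
    exact S.le_limit _ _ k h
  · intro x f _ _ hf h
    have e : eval S (.limit f) = _ := dif_pos (hf f rfl)
    rw [e]
    exact S.limit_le _ _ h

theorem eval_limit {A : Type u} (S : Alg A) {f : ℕ → RawBrw} (h : WF (.limit f)) :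
    ∃ h' : ∀ k, S.le (S.succ (eval S (f k))) (eval S (f (k + 1))),
      eval S (.limit f) = S.limit ⟨fun k => eval S (f k), h'⟩ := by
  cases h with
  | limit _ h => exact ⟨fun k => eval_le S (h k), dif_pos fun k => eval_le S (h k)⟩

theorem eval_eq {A : Type u} (S : Alg A) {x y : RawBrw} (h : Eqv x y) :
    eval S x = eval S y := by
  induction h with
  | refl => rfl
  | symm _ ih => exact ih.symm
  | trans _ _ ih₁ ih₂ => exact ih₁.trans ih₂
  | succ _ ih => exact congrArg S.succ ih
  | bisim hf hg h₁ h₂ =>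
    obtain ⟨_, e₁⟩ := eval_limit S hf
    obtain ⟨_, e₂⟩ := eval_limit S hg
    rw [e₁, e₂]
    exact S.bisim _ _ (fun k => (h₁ k).imp fun _ => eval_le S)
      (fun k => (h₂ k).imp fun _ => eval_le S)

theorem existsUnique_isHom {A : Type u} (S : Alg A) : ∃! φ : Brw → A, IsHom S φ := by
  refine ⟨fun x => eval S (rep x).1, ?_, ?_⟩
  · have hmk : ∀ a, eval S (rep (mk a)).1 = eval S a.1 := fun a =>
      eval_eq S (mk_eq_mk.1 (mk_rep (mk a)))
    refine ⟨fun x y h => eval_le S (rep_le h), hmk _, fun x => ?_, fun f => ?_⟩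
    · have h := hmk ⟨_, .succ (rep x).2⟩
      rwa [← succ_mk, mk_rep] at h
    · obtain ⟨_, e⟩ := eval_limit S (wf_limit_rep f)
      exact (hmk _).trans e
  · intro ψ hψ
    funext x
    have hmk : ∀ a, eval S (rep (mk a)).1 = eval S a.1 := fun a =>
      eval_eq S (mk_eq_mk.1 (mk_rep (mk a)))
    induction x using Brw.induction with
    | h₀ => exact hψ.map_zero.trans (hmk ⟨.zero, .zero⟩).symm
    | h₁ x ih =>
      have h := hmk ⟨_, .succ (rep x).2⟩
      rw [← succ_mk, mk_rep] at h
      rw [hψ.map_succ, ih]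
      exact h.symm
    | h₂ f ih =>
      obtain ⟨_, e⟩ := eval_limit S (wf_limit_rep f)
      rw [hψ.map_limit]
      refine Eq.trans ?_ ((hmk _).trans e).symm
      congr 1
      exact Subtype.ext (funext ih)

/-! ## The recursion equations of the arithmetic operations -/

/-- The recursion equations for addition. -/
structure AddRec (add : Brw → Brw → Brw) : Prop where
  at_zero : ∀ x, add x zero = x
  at_succ : ∀ x y, add x (succ y) = succ (add x y)
  at_limit : ∀ (x : Brw) (f : IncSeq Brw),
    ∃ h : ∀ k, add x (f.1 k) < add x (f.1 (k + 1)),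
      add x (limit f) = limit ⟨fun k => add x (f.1 k), h⟩

/-- The recursion equations for multiplication. -/
structure MulRec (add mul : Brw → Brw → Brw) : Prop where
  at_zero : ∀ x, mul x zero = zero
  at_succ : ∀ x y, mul x (succ y) = add (mul x y) x
  zero_at_limit : ∀ (x : Brw) (f : IncSeq Brw), x = zero → mul x (limit f) = zero
  at_limit : ∀ (x : Brw) (f : IncSeq Brw), x ≠ zero →
    ∃ h : ∀ k, mul x (f.1 k) < mul x (f.1 (k + 1)),
      mul x (limit f) = limit ⟨fun k => mul x (f.1 k), h⟩

/-- The recursion equations for exponentiation (`exp x y` is `x` to the power `y`). -/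
structure ExpRec (mul exp : Brw → Brw → Brw) : Prop where
  at_zero : ∀ x, exp x zero = succ zero
  at_succ : ∀ x y, exp x (succ y) = mul (exp x y) x
  zero_at_limit : ∀ (x : Brw) (f : IncSeq Brw), x = zero → exp x (limit f) = zero
  one_at_limit : ∀ (x : Brw) (f : IncSeq Brw), x = succ zero → exp x (limit f) = succ zero
  at_limit : ∀ (x : Brw) (f : IncSeq Brw), x ≠ zero → x ≠ succ zero →
    ∃ h : ∀ k, exp x (f.1 k) < exp x (f.1 (k + 1)),
      exp x (limit f) = limit ⟨fun k => exp x (f.1 k), h⟩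

end Brw

-- Classically, Brouwer trees are faithfully represented by ordinals. Initiality gives a map `rank`
-- to `Ordinal`, sending `limit` to the supremum. It preserves `≤` by construction, reflects it by
-- `le_of_rank_le`, and is injective by `rank_injective`. The order laws are thus either inherited
-- from the ordinals or instances of transitivity.
--
-- The operations are pulled back along `rank`. Its range is closed under ordinal sum, product and
-- power, by induction on the second argument; at limits this uses that the ordinal operation is
-- normal in that argument. The exceptions are base `0` for products and bases `0` and `1` for
-- powers, which are treated by hand. Injectivity turns ordinal identities into the recursion
-- equations. Uniqueness is induction on trees: each clause of a specification forces the value,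
-- since the successors and suprema it asks for exist.

namespace Brw

-- The rank of a Brouwer tree

/-- The ordinals carry all constructors of Brouwer trees. -/
noncomputable def ordinalAlg : Alg Ordinal.{0} where
  le a b := a ≤ b
  zero := 0
  succ := Order.succ
  limit f := ⨆ k, f.1 k
  bisim f g h₁ h₂ := le_antisymm
    (Ordinal.iSup_le fun k => (h₁ k).elim fun n hn => hn.trans (Ordinal.le_iSup g.1 n))
    (Ordinal.iSup_le fun k => (h₂ k).elim fun n hn => hn.trans (Ordinal.le_iSup f.1 n))
  zero_le _ := bot_le
  le_trans _ _ _ h₁ h₂ := h₁.trans h₂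
  succ_mono _ _ h := Order.succ_le_succ h
  le_limit _ f k h := h.trans (Ordinal.le_iSup f.1 k)
  limit_le _ _ h := Ordinal.iSup_le h

/-- The ordinal that a Brouwer tree denotes. -/
noncomputable def rank : Brw → Ordinal.{0} := (existsUnique_isHom ordinalAlg).choose

theorem isHom_rank : IsHom ordinalAlg rank := (existsUnique_isHom ordinalAlg).choose_spec.1

theorem rank_zero : rank zero = 0 := isHom_rank.map_zero

theorem rank_succ (x : Brw) : rank (succ x) = rank x + 1 :=
  (isHom_rank.map_succ x).trans (Order.succ_eq_add_one _)

theorem rank_limit (f : IncSeq Brw) : rank (limit f) = ⨆ k, rank (f.1 k) :=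
  isHom_rank.map_limit f

theorem rank_le_of_le {x y : Brw} (h : x ≤ y) : rank x ≤ rank y := isHom_rank.map_le x y h

/-- An ordinal strictly below a supremum is strictly below one of its terms; this classical choice
of an index `k` settles the case of a successor against a limit. -/
theorem le_of_rank_le {x y : Brw} (h : rank x ≤ rank y) : x ≤ y := by
  induction x using Brw.induction generalizing y with
  | h₀ => exact zero_le y
  | h₁ x ih =>
    rw [rank_succ, Order.add_one_le_iff] at h
    induction y using Brw.induction with
    | h₀ => simp [rank_zero] at h
    | h₁ y _ =>
      rw [rank_succ, Order.lt_add_one_iff] at h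
      exact succ_mono (ih h)
    | h₂ f ihf =>
      rw [rank_limit, Ordinal.lt_iSup_iff] at h
      obtain ⟨k, hk⟩ := h
      exact le_limit _ f k (ihf k hk)
  | h₂ f ih =>
    refine limit_le y f fun k => ih k (_root_.le_trans ?_ h)
    rw [rank_limit]
    exact Ordinal.le_iSup (fun k => rank (f.1 k)) k

theorem rank_le_iff {x y : Brw} : rank x ≤ rank y ↔ x ≤ y := ⟨le_of_rank_le, rank_le_of_le⟩

theorem rank_lt_iff {x y : Brw} : rank x < rank y ↔ x < y := by
  rw [← Order.add_one_le_iff, ← rank_succ, rank_le_iff]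
  rfl

theorem rank_lt_rank_limit (f : IncSeq Brw) (k : ℕ) : rank (f.1 k) < rank (limit f) := by
  rw [rank_limit, Ordinal.lt_iSup_iff]
  exact ⟨k + 1, rank_lt_iff.2 (f.2 k)⟩

/-- The terms increase strictly, so the supremum of their ranks is not attained. This separates
`limit` from the other two constructors. -/
theorem isSuccLimit_rank_limit (f : IncSeq Brw) : Order.IsSuccLimit (rank (limit f)) := by
  rw [Order.isSuccLimit_iff, Order.isSuccPrelimit_iff_succ_lt]
  refine ⟨fun h => h.not_lt (rank_lt_rank_limit f 0), fun b hb => ?_⟩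
  rw [rank_limit, Ordinal.lt_iSup_iff] at hb
  obtain ⟨k, hk⟩ := hb
  exact (Order.succ_le_of_lt hk).trans_lt (rank_lt_rank_limit f k)

/-- Ranks of different constructors differ in kind: zero, successor, limit. Successors cancel, and
two limits of equal rank have mutually cofinal sequences, so `bisim` identifies them. -/
theorem rank_injective : Function.Injective rank := by
  intro x
  induction x using Brw.induction with
  | h₀ =>
    intro y h
    induction y using Brw.induction with
    | h₀ => rfl
    | h₁ y _ => simp [rank_zero, rank_succ, eq_comm (a := (0 : Ordinal))] at h
    | h₂ g _ => exact absurd (h.symm.trans rank_zero) (isSuccLimit_rank_limit g).ne_bot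
  | h₁ x ih =>
    intro y h
    induction y using Brw.induction with
    | h₀ => simp [rank_zero, rank_succ] at h
    | h₁ y _ =>
      rw [rank_succ, rank_succ] at h
      rw [ih (Order.succ_injective (by simpa only [Order.succ_eq_add_one] using h))]
    | h₂ g _ =>
      rw [rank_succ, ← Order.succ_eq_add_one] at h
      exact absurd (h ▸ isSuccLimit_rank_limit g) (Order.not_isSuccLimit_succ _)
  | h₂ f ih =>
    intro y h
    induction y using Brw.induction with
    | h₀ => exact absurd (h.trans rank_zero) (isSuccLimit_rank_limit f).ne_bot
    | h₁ y _ =>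
      rw [rank_succ, ← Order.succ_eq_add_one] at h
      exact absurd (h ▸ isSuccLimit_rank_limit f) (Order.not_isSuccLimit_succ _)
    | h₂ g _ =>
      have cofinal : ∀ {f g : IncSeq Brw}, rank (limit f) = rank (limit g) →
          ∀ k, ∃ n, f.1 k ≤ g.1 n := by
        intro f g h k
        have hk := rank_lt_rank_limit f k
        rw [h, rank_limit, Ordinal.lt_iSup_iff] at hk
        exact hk.imp fun n hn => le_of_rank_le hn.le
      exact bisim f g (cofinal h) (cofinal h.symm)

-- Order laws; zeros, successors and limits in terms of constructors

theorem ordinalAssumptions : OrdinalAssumptions Brw where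
  lt_trans _ _ _ h₁ h₂ := rank_lt_iff.1 ((rank_lt_iff.2 h₁).trans (rank_lt_iff.2 h₂))
  lt_irrefl _ h := (rank_lt_iff.2 h).false
  le_refl _ := rank_le_iff.1 le_rfl
  le_trans _ _ _ := le_trans
  le_antisymm _ _ h₁ h₂ := rank_injective ((rank_le_of_le h₁).antisymm (rank_le_of_le h₂))
  le_of_lt _ _ h := rank_le_iff.1 (rank_lt_iff.2 h).le
  lt_of_lt_of_le _ _ _ h₁ h₂ := le_trans h₁ h₂

theorem isZeroElt_iff {a : Brw} : IsZeroElt a ↔ a = zero :=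
  ⟨fun h => ordinalAssumptions.le_antisymm _ _ (h _) (zero_le _), fun h => h ▸ zero_le⟩

theorem isSucOf_iff {a b : Brw} : IsSucOf a b ↔ a = succ b :=
  ⟨fun h => ordinalAssumptions.le_antisymm _ _ (h.2 _ (ordinalAssumptions.le_refl _)) h.1,
    fun h => h ▸ ⟨ordinalAssumptions.le_refl _, fun _ hx => hx⟩⟩

theorem isSupOf_unique {a b : Brw} {f : ℕ → Brw} (ha : IsSupOf a f) (hb : IsSupOf b f) : a = b :=
  ordinalAssumptions.le_antisymm _ _ (ha.2 _ hb.1) (hb.2 _ ha.1)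

theorem isLimOf_limit (f : IncSeq Brw) : IsLimOf (limit f) f :=
  ⟨fun k => le_limit _ f k (ordinalAssumptions.le_refl _), fun b hb => limit_le b f hb⟩

theorem isLimOf_iff {a : Brw} {f : IncSeq Brw} : IsLimOf a f ↔ a = limit f :=
  ⟨fun h => isSupOf_unique h (isLimOf_limit f), fun h => h ▸ isLimOf_limit f⟩

/-- For the degenerate bases, where the sequence of values is constant and `limit` does not apply.
-/
theorem isSupOf_const (a : Brw) : IsSupOf a fun _ : ℕ => a :=
  ⟨fun _ => ordinalAssumptions.le_refl a, fun _ h => h 0⟩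

-- Arithmetic transported from the ordinals

/-- A normal function commutes with limits of Brouwer trees. -/
theorem map_rank_limit {F : Ordinal.{0} → Ordinal.{0}} (hF : Order.IsNormal F) {g : Brw → Brw}
    (hg : ∀ y, rank (g y) = F (rank y)) (f : IncSeq Brw) :
    ∃ h : ∀ k, g (f.1 k) < g (f.1 (k + 1)), g (limit f) = limit ⟨fun k => g (f.1 k), h⟩ := by
  have h : ∀ k, g (f.1 k) < g (f.1 (k + 1)) := fun k => by
    rw [← rank_lt_iff, hg, hg]
    exact hF.strictMono (rank_lt_iff.2 (f.2 k))
  refine ⟨h, rank_injective ?_⟩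
  -- Normal functions preserve suprema of nonempty bounded families, and every sequence of ordinals
  -- is bounded.
  rw [hg, rank_limit, rank_limit, hF.map_iSup (Ordinal.bddAbove_of_small)]
  simp only [hg]

/-- The range of `rank` contains the values of a normal function at limits. -/
theorem exists_rank_eq_map_limit {F : Ordinal.{0} → Ordinal.{0}} (hF : Order.IsNormal F)
    (f : IncSeq Brw) (h : ∀ k, ∃ z, rank z = F (rank (f.1 k))) :
    ∃ z, rank z = F (rank (limit f)) := by
  choose z hz using h
  refine ⟨limit ⟨z, fun k => ?_⟩, ?_⟩
  · rw [← rank_lt_iff, hz, hz]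
    exact hF.strictMono (rank_lt_iff.2 (f.2 k))
  · rw [rank_limit, rank_limit, hF.map_iSup (Ordinal.bddAbove_of_small)]
    simp only [hz]

/-- Not every ordinal is a rank, so the sum has to be built along `y`. -/
theorem exists_rank_eq_add (x y : Brw) : ∃ z, rank z = rank x + rank y := by
  induction y using Brw.induction with
  | h₀ => exact ⟨x, by rw [rank_zero, add_zero]⟩
  | h₁ y ih =>
    obtain ⟨z, hz⟩ := ih
    exact ⟨succ z, by rw [rank_succ, rank_succ, hz, add_assoc]⟩
  | h₂ f ih => exact exists_rank_eq_map_limit (Ordinal.isNormal_add_right _) f ih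

/-- Addition of Brouwer trees. -/
noncomputable def add (x y : Brw) : Brw := (exists_rank_eq_add x y).choose

theorem rank_add (x y : Brw) : rank (add x y) = rank x + rank y :=
  (exists_rank_eq_add x y).choose_spec

theorem rank_pos {x : Brw} (hx : x ≠ zero) : 0 < rank x :=
  pos_iff_ne_zero.2 fun h => hx (rank_injective (h.trans rank_zero.symm))

theorem rank_one : rank (succ zero) = 1 := by
  rw [rank_succ, rank_zero, zero_add]

theorem one_lt_rank {x : Brw} (hx : x ≠ zero) (hx' : x ≠ succ zero) : 1 < rank x :=
  lt_of_le_of_ne (Order.one_le_iff_pos.2 (rank_pos hx))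
    fun h => hx' (rank_injective (h.symm.trans rank_one.symm))

theorem exists_rank_eq_mul (x y : Brw) : ∃ z, rank z = rank x * rank y := by
  -- Left multiplication by `0` is constant, hence not normal.
  by_cases hx : x = zero
  · exact ⟨zero, by rw [hx, rank_zero, zero_mul]⟩
  induction y using Brw.induction with
  | h₀ => exact ⟨zero, by rw [rank_zero, mul_zero]⟩
  | h₁ y ih =>
    obtain ⟨z, hz⟩ := ih
    exact ⟨add z x, by rw [rank_add, rank_succ, hz, mul_add_one]⟩
  | h₂ f ih => exact exists_rank_eq_map_limit (Ordinal.isNormal_mul_right (rank_pos hx)) f ih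

/-- Multiplication of Brouwer trees. -/
noncomputable def mul (x y : Brw) : Brw := (exists_rank_eq_mul x y).choose

theorem rank_mul (x y : Brw) : rank (mul x y) = rank x * rank y :=
  (exists_rank_eq_mul x y).choose_spec

theorem exists_rank_eq_opow (x y : Brw) : ∃ z, rank z = rank x ^ rank y := by
  by_cases hx : x = zero
  -- Powers of `0` are not even monotone in the exponent: `0 ^ 0 = 1`, and all others vanish.
  · by_cases hy : y = zero
    · exact ⟨succ zero, by rw [hy, rank_one, rank_zero, Ordinal.opow_zero]⟩
    · exact ⟨zero, by rw [hx, rank_zero, Ordinal.zero_opow (rank_pos hy).ne']⟩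
  by_cases hx' : x = succ zero
  · exact ⟨succ zero, by rw [hx', rank_one, Ordinal.one_opow]⟩
  induction y using Brw.induction with
  | h₀ => exact ⟨succ zero, by rw [rank_one, rank_zero, Ordinal.opow_zero]⟩
  | h₁ y ih =>
    obtain ⟨z, hz⟩ := ih
    exact ⟨mul z x, by rw [rank_mul, rank_succ, hz, Ordinal.opow_add_one]⟩
  | h₂ f ih => exact exists_rank_eq_map_limit (Ordinal.isNormal_opow (one_lt_rank hx hx')) f ih

/-- Exponentiation of Brouwer trees: `exp x y` is `x` to the power `y`. -/
noncomputable def exp (x y : Brw) : Brw := (exists_rank_eq_opow x y).choose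

theorem rank_exp (x y : Brw) : rank (exp x y) = rank x ^ rank y :=
  (exists_rank_eq_opow x y).choose_spec

-- Recursion equations

theorem addRec_add : AddRec add where
  at_zero x := rank_injective (by rw [rank_add, rank_zero, add_zero])
  at_succ x y := rank_injective (by
    rw [rank_add, rank_succ, rank_succ, rank_add, add_assoc])
  at_limit x f := map_rank_limit (Ordinal.isNormal_add_right _) (rank_add x) f

theorem mulRec_mul : MulRec add mul where
  at_zero x := rank_injective (by rw [rank_mul, rank_zero, mul_zero])
  at_succ x y := rank_injective (by
    rw [rank_mul, rank_succ, rank_add, rank_mul, mul_add_one])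
  zero_at_limit x f hx := rank_injective (by rw [rank_mul, hx, rank_zero, zero_mul])
  at_limit x f hx := map_rank_limit (Ordinal.isNormal_mul_right (rank_pos hx)) (rank_mul x) f

theorem one_exp (y : Brw) : exp (succ zero) y = succ zero :=
  rank_injective (by rw [rank_exp, rank_one, Ordinal.one_opow])

theorem mul_zero_left (y : Brw) : mul zero y = zero :=
  rank_injective (by rw [rank_mul, rank_zero, zero_mul])

theorem expRec_exp : ExpRec mul exp where
  at_zero x := rank_injective (by rw [rank_exp, rank_one, rank_zero, Ordinal.opow_zero])
  at_succ x y := rank_injective (by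
    rw [rank_exp, rank_succ, rank_mul, rank_exp, Ordinal.opow_add_one])
  zero_at_limit x f hx := rank_injective (by
    rw [rank_exp, hx, rank_zero, Ordinal.zero_opow (isSuccLimit_rank_limit f).ne_bot])
  one_at_limit x f hx := by rw [hx, one_exp]
  at_limit x f hx hx' :=
    map_rank_limit (Ordinal.isNormal_opow (one_lt_rank hx hx')) (rank_exp x) f

-- Specifications and uniqueness

theorem isSupOf_add_limit (c : Brw) (f : IncSeq Brw) :
    IsSupOf (add c (limit f)) fun i => add c (f.1 i) := by
  obtain ⟨h, e⟩ := addRec_add.at_limit c f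
  rw [e]
  exact isLimOf_limit ⟨_, h⟩

theorem isSupOf_mul_limit (c : Brw) (f : IncSeq Brw) :
    IsSupOf (mul c (limit f)) fun i => mul c (f.1 i) := by
  by_cases hc : c = zero
  · simp only [hc, mul_zero_left]
    exact isSupOf_const zero
  obtain ⟨h, e⟩ := mulRec_mul.at_limit c f hc
  rw [e]
  exact isLimOf_limit ⟨_, h⟩

/-- Base zero must be excluded: a sequence starting at exponent `0` has first value one, while the
power at the limit is zero. -/
theorem isSupOf_exp_limit {c : Brw} (hc : c ≠ zero) (f : IncSeq Brw) :
    IsSupOf (exp c (limit f)) fun i => exp c (f.1 i) := by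
  by_cases hc' : c = succ zero
  · simp only [hc', one_exp]
    exact isSupOf_const _
  obtain ⟨h, e⟩ := expRec_exp.at_limit c f hc hc'
  rw [e]
  exact isLimOf_limit ⟨_, h⟩

theorem isAddition_add : IsAddition add where
  zero a c ha := by rw [isZeroElt_iff.1 ha, addRec_add.at_zero]
  succ a b c d ha hd := by rw [isSucOf_iff.1 ha, isSucOf_iff.1 hd, addRec_add.at_succ]
  lim a b c f ha hb := by
    rw [isLimOf_iff.1 ha]
    exact isSupOf_unique (isSupOf_add_limit c f) hb

theorem isMultiplication_mul : IsMultiplication add mul where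
  zero a c ha := by rw [isZeroElt_iff.1 ha, mulRec_mul.at_zero]
  succ a b c ha := by rw [isSucOf_iff.1 ha, mulRec_mul.at_succ]
  lim a b c f ha hb := by
    rw [isLimOf_iff.1 ha]
    exact isSupOf_unique (isSupOf_mul_limit c f) hb

theorem isExponentiation_exp (c : Brw) : IsExponentiation mul c (exp c) where
  zero a b hb ha := by
    rw [isSucOf_iff.1 ha, isZeroElt_iff.1 hb, expRec_exp.at_zero]
  succ a b ha := by rw [isSucOf_iff.1 ha, expRec_exp.at_succ]
  lim a b f ha hc hb := by
    rw [isLimOf_iff.1 ha]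
    exact isSupOf_unique (isSupOf_exp_limit (fun h => hc (isZeroElt_iff.2 h)) f) hb
  lim_of_zero a f ha hc := by
    rw [isLimOf_iff.1 ha, isZeroElt_iff.1 hc, expRec_exp.zero_at_limit _ f rfl]

theorem _root_.IsAddition.eq_add {p : Brw → Brw → Brw} (hp : IsAddition p) : p = add := by
  funext c y
  induction y using Brw.induction with
  | h₀ => rw [hp.zero _ _ zero_le, addRec_add.at_zero]
  | h₁ y ih => rw [hp.succ _ y c _ (isSucOf_iff.2 rfl) (isSucOf_iff.2 rfl), ih, addRec_add.at_succ]
  | h₂ f ih =>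
    -- By induction the values of `p` along `f` are those of `add`, whose supremum is already known;
    -- the limit clause then fixes the value.
    refine hp.lim _ _ c f (isLimOf_limit f) ?_
    simp only [ih]
    exact isSupOf_add_limit c f

theorem _root_.IsMultiplication.eq_mul {m : Brw → Brw → Brw} (hm : IsMultiplication add m) :
    m = mul := by
  funext c y
  induction y using Brw.induction with
  | h₀ => rw [hm.zero _ _ zero_le, mulRec_mul.at_zero]
  | h₁ y ih => rw [hm.succ _ y c (isSucOf_iff.2 rfl), ih, mulRec_mul.at_succ]
  | h₂ f ih =>
    refine hm.lim _ _ c f (isLimOf_limit f) ?_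
    simp only [ih]
    exact isSupOf_mul_limit c f

theorem _root_.IsExponentiation.eq_exp {c : Brw} {e : Brw → Brw}
    (he : IsExponentiation mul c e) : e = exp c := by
  funext y
  induction y using Brw.induction with
  | h₀ => rw [he.zero _ _ zero_le (isSucOf_iff.2 rfl), expRec_exp.at_zero]
  | h₁ y ih => rw [he.succ _ y (isSucOf_iff.2 rfl), ih, expRec_exp.at_succ]
  | h₂ f ih =>
    by_cases hc : c = zero
    · rw [he.lim_of_zero _ f (isLimOf_limit f) (isZeroElt_iff.2 hc),
        expRec_exp.zero_at_limit c f hc, hc]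
    · refine he.lim _ _ f (isLimOf_limit f) (fun h => hc (isZeroElt_iff.1 h)) ?_
      simp only [ih]
      exact isSupOf_exp_limit hc f

theorem hasUniqueAddition : HasUniqueAddition Brw :=
  ⟨add, isAddition_add, fun _ h => h.eq_add⟩

theorem hasUniqueMultiplication : HasUniqueMultiplication Brw := by
  refine ⟨hasUniqueAddition, fun p hp => ?_⟩
  -- Uniqueness of addition reduces an arbitrary addition to `add`, relative to which `mul` was
  -- characterized.
  obtain rfl := hp.eq_add
  exact ⟨mul, isMultiplication_mul, fun _ h => h.eq_mul⟩

theorem hasUniqueExponentiation (c : Brw) : HasUniqueExponentiation c := by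
  refine ⟨hasUniqueMultiplication, fun p m hp hm => ?_⟩
  obtain rfl := hp.eq_add
  obtain rfl := hm.eq_mul
  exact ⟨exp c, isExponentiation_exp c, fun _ h => h.eq_exp⟩

end Brw

theorem theorem42 :
    OrdinalAssumptions Brw ∧
    HasUniqueAddition Brw ∧
    HasUniqueMultiplication Brw ∧
    (∀ c : Brw, HasUniqueExponentiation c) ∧
    ∃ add mul exp : Brw → Brw → Brw,
      Brw.AddRec add ∧ Brw.MulRec add mul ∧ Brw.ExpRec mul exp ∧
      IsAddition add ∧ IsMultiplication add mul ∧ ∀ c : Brw, IsExponentiation mul c (exp c) :=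
  ⟨Brw.ordinalAssumptions, Brw.hasUniqueAddition, Brw.hasUniqueMultiplication,
    Brw.hasUniqueExponentiation, Brw.add, Brw.mul, Brw.exp, Brw.addRec_add, Brw.mulRec_mul,
    Brw.expRec_exp, Brw.isAddition_add, Brw.isMultiplication_mul, Brw.isExponentiation_exp⟩
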